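/- Let $p$ be a prime, let $k$ be an algebraically closed field of characteristic $p$, and let $G$ be a finite group. A finite-dimensional $kG$-module $M$ is called endotrivial if $M \otimes_k M^{*} \cong k \oplus P$ as $kG$-modules, where $k$ is the trivial module and $P$ is a projective $kG$-module. A component of $G$ is a subnormal subgroup $L$ that is quasi-simple, that is, $L$ is perfect and $L/Z(L)$ is simple. Let $V$ be a simple endotrivial $kG$-module and let $N$ be a subnormal subgroup of $G$ whose order is divisible by $p$. Then the restriction $\mathrm{Res}^{G}_{N}(V)$ is a simple $kN$-module. If, moreover, $N$ is a component of $G$, $V$ is faithful and $\dim_k V > 1$, then $C_G(N) = Z(G)$, and $N$ is the unique component of $G$. -/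

import Mathlib

open scoped MonoidAlgebra

universe u v w

/-- A finite-dimensional `kG`-module `V`, given as a representation `ρ`, is endotrivial if
`V ⊗ V* ≅ k ⊕ P` as `kG`-modules, with `k` the trivial module and `P` projective. -/
def Representation.IsEndotrivial {k : Type u} {G : Type w} {V : Type v} [Field k] [Group G]
    [AddCommGroup V] [Module k V] (ρ : Representation k G V) : Prop :=
  FiniteDimensional k V ∧
    ∃ (P : Type (max u v)) (_ : AddCommGroup P) (_ : Module k P) (σ : Representation k G P),
      Module.Projective k[G] σ.asModule ∧
      Nonempty ((ρ.tprod ρ.dual).Equiv ((Representation.trivial k G k).prod σ))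

/-- A group is quasi-simple if it is perfect and its quotient by its centre is simple. -/
def IsQuasisimpleGroup (L : Type w) [Group L] : Prop :=
  Group.IsPerfect L ∧ IsSimpleGroup (L ⧸ Subgroup.center L)

/-- A component of a group is a quasi-simple subnormal subgroup. -/
def Subgroup.IsComponent {G : Type w} [Group G] (L : Subgroup G) : Prop :=
  L.IsSubnormal ∧ IsQuasisimpleGroup L

/-! Simplicity descends one step of a subnormal chain at a time. If `N` is normal in `K` and `V` is
simple on `K`, Clifford makes `V` semisimple on `N`. Since `End V = V ⊗ V* = k ⊕ P` and `p` divides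
`|N|`, modulo relative traces `End_{kN}(V)` is the line spanned by `1` (`relTrace_spec`). Hence in
`V = U ⊕ W` one summand is projective over `N`. The largest projective summand is `K`-stable and is
not `V`, so it vanishes; thus `U` or `W` is zero (`of_relTrace`). For a component `N`, Schur and
faithfulness make `C_G(N)` central. Another component would centralize `N`
(`commutator_eq_bot_of_ne`), hence be central, which is impossible. -/

/-! ### Components and commutators. -/

section Components

open scoped commutatorElement

variable {G : Type*} [Group G]

/-- If the image of `M` is all of `L/Z(L)`, then `M Z(L) = L`; central factors drop out of
commutators, so `L = [L, L] ≤ M`. -/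
theorem IsQuasisimpleGroup.eq_top_or_le_center {L : Type*} [Group L] (hL : IsQuasisimpleGroup L)
    (M : Subgroup L) [M.Normal] : M = ⊤ ∨ M ≤ Subgroup.center L := by
  obtain ⟨hperf, hsimp⟩ := hL
  have hn : (M.map (QuotientGroup.mk' (Subgroup.center L))).Normal :=
    Subgroup.Normal.map inferInstance _ (QuotientGroup.mk'_surjective _)
  rcases hn.eq_bot_or_eq_top with h | h
  · right
    rwa [Subgroup.map_eq_bot_iff, QuotientGroup.ker_mk'] at h
  · left
    have hsup : M ⊔ Subgroup.center L = ⊤ := by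
      have := congrArg (Subgroup.comap (QuotientGroup.mk' (Subgroup.center L))) h
      rwa [Subgroup.comap_map_eq, QuotientGroup.ker_mk', Subgroup.comap_top] at this
    rw [eq_top_iff, ← hperf.commutator_eq_top, commutator_def, Subgroup.commutator_le]
    intro x _ y _
    have key : ∀ z : L, ∃ m ∈ M, ∃ c ∈ Subgroup.center L, m * c = z := fun z ↦
      Subgroup.mem_sup_of_normal_right.1 (by rw [hsup]; exact Subgroup.mem_top z)
    obtain ⟨m, hm, c, hc, rfl⟩ := key x
    obtain ⟨n, hn', d, hd, rfl⟩ := key y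
    have : ⁅m * c, n * d⁆ = ⁅m, n⁆ := by
      have hc := fun z ↦ (Subgroup.mem_center_iff.1 hc z)
      have hd := fun z ↦ (Subgroup.mem_center_iff.1 hd z)
      simp only [commutatorElement_def, mul_inv_rev]
      calc m * c * (n * d) * (c⁻¹ * m⁻¹) * (d⁻¹ * n⁻¹)
          = m * (c * (n * d)) * (c⁻¹ * m⁻¹) * (d⁻¹ * n⁻¹) := by group
        _ = m * n * (d * m⁻¹) * (d⁻¹ * n⁻¹) := by rw [← hc (n * d)]; group
        _ = m * n * m⁻¹ * n⁻¹ := by rw [← hd m⁻¹]; group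
    rw [this, commutatorElement_def]
    exact M.mul_mem (M.mul_mem (M.mul_mem hm hn') (M.inv_mem hm)) (M.inv_mem hn')

namespace Subgroup

/-- Three subgroups lemma for a perfect subgroup. -/
theorem commutator_eq_bot_of_commutator_commutator_eq_bot {H N : Subgroup G} [Group.IsPerfect N]
    (h : ⁅⁅H, N⁆, N⁆ = ⊥) : ⁅H, N⁆ = ⊥ := by
  have h2 : ⁅⁅N, H⁆, N⁆ = ⊥ := by rwa [commutator_comm N H]
  have := commutator_commutator_eq_bot_of_rotate h2 h
  rwa [commutator_eq_self, commutator_comm] at this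

theorem commutator_le_left_of_le_normalizer {H N : Subgroup G} (h : N ≤ normalizer (H : Set G)) :
    ⁅H, N⁆ ≤ H := by
  rw [commutator_le]
  intro x hx y hy
  rw [commutatorElement_def, mul_assoc, mul_assoc, ← mul_assoc y]
  exact H.mul_mem hx ((mem_normalizer_iff.1 (h hy) _).1 (H.inv_mem hx))

/-- If `N` is perfect, normalizes `H` and centralizes `H ⊓ K` for some subnormal `K` containing
`N`, then `N` centralizes `H`. -/
theorem IsSubnormal.commutator_eq_bot_of_inf {N H K : Subgroup G} [Group.IsPerfect N]
    (hK : K.IsSubnormal) (hNK : N ≤ K) (hNH : N ≤ normalizer (H : Set G)) (h : ⁅H ⊓ K, N⁆ = ⊥) :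
    ⁅H, N⁆ = ⊥ := by
  induction hK with
  | top => simpa using h
  | step K K' hle _ hn ih =>
    -- As `K'` normalizes `K`, `[H ⊓ K', N] ≤ H ⊓ K`, which `N` centralizes.
    refine ih (hNK.trans hle) (commutator_eq_bot_of_commutator_commutator_eq_bot ?_)
    rw [eq_bot_iff, ← h]
    refine commutator_mono (le_inf ?_ ?_) le_rfl
    · exact (commutator_mono inf_le_left le_rfl).trans (commutator_le_left_of_le_normalizer hNH)
    · rw [normal_subgroupOf_iff_le_normalizer hle] at hn
      rw [commutator_comm]
      exact (commutator_mono hNK inf_le_right).trans (commutator_le_left_of_le_normalizer hn)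

/-- `H ⊓ N` is normal in `N`, so it is `N` or central in `N`; subnormality of `N` lifts the second
case to `H`. -/
theorem IsComponent.le_or_commutator_eq_bot_of_le_normalizer {N H : Subgroup G}
    (hN : N.IsComponent) (hNH : N ≤ normalizer (H : Set G)) : N ≤ H ∨ ⁅H, N⁆ = ⊥ := by
  have := hN.2.1
  have hn : (H.subgroupOf N).Normal := normal_subgroupOf_of_le_normalizer hNH
  rcases hN.2.eq_top_or_le_center (H.subgroupOf N) with h | h
  · exact Or.inl (subgroupOf_eq_top.1 h)
  · refine Or.inr (hN.1.commutator_eq_bot_of_inf le_rfl hNH ?_)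
    rw [commutator_eq_bot_iff_le_centralizer]
    intro x hx
    rw [mem_centralizer_iff]
    intro y hy
    have : (⟨x, hx.2⟩ : N) ∈ center N := h (mem_subgroupOf.2 hx.1)
    exact congrArg Subtype.val (mem_center_iff.1 this ⟨y, hy⟩)

/-- A component is contained in, or centralizes, any subnormal subgroup. -/
theorem IsComponent.le_or_commutator_eq_bot {N U : Subgroup G} (hN : N.IsComponent)
    (hU : U.IsSubnormal) : N ≤ U ∨ ⁅U, N⁆ = ⊥ := by
  induction hU with
  | top => exact Or.inl le_top
  | step U K hle _ hn ih =>
    rcases ih with h | h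
    · rw [normal_subgroupOf_iff_le_normalizer hle] at hn
      exact hN.le_or_commutator_eq_bot_of_le_normalizer (h.trans hn)
    · exact Or.inr (eq_bot_iff.2 ((commutator_mono hle le_rfl).trans h.le))

/-- Distinct components centralize each other. -/
theorem IsComponent.commutator_eq_bot_of_ne {N L : Subgroup G} (hN : N.IsComponent)
    (hL : L.IsComponent) (hne : L ≠ N) : ⁅L, N⁆ = ⊥ := by
  rcases hN.le_or_commutator_eq_bot hL.1 with h | h
  · rcases hL.le_or_commutator_eq_bot hN.1 with h' | h'
    · exact absurd (le_antisymm h' h) hne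
    · rwa [commutator_comm]
  · exact h

theorem IsComponent.not_le_center {L : Subgroup G} (hL : L.IsComponent) : ¬ L ≤ center G := by
  intro h
  have := hL.2.2.toNontrivial
  rw [QuotientGroup.nontrivial_iff] at this
  refine this (eq_top_iff.2 fun x _ ↦ mem_center_iff.2 fun y ↦ Subtype.ext ?_)
  exact mem_center_iff.1 (h x.2) y

end Subgroup

end Components

/-! ### Relative traces and endotriviality. -/

namespace Representation

section RelTrace

variable {k G V : Type*} [Field k] [Group G] [AddCommGroup V] [Module k V]

/-- In a projective `kG`-module, every vector fixed by a finite subgroup `H` is an `H`-norm. -/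
theorem exists_sum_eq_of_projective {P : Type*} [AddCommGroup P] [Module k P]
    (σ : Representation k G P) (hσ : Module.Projective k[G] σ.asModule) (H : Subgroup G)
    [Fintype H] (x : P) (hx : ∀ h ∈ H, σ h x = x) : ∃ y, ∑ h : H, σ h y = x := by
  classical
  obtain ⟨s, hs⟩ := hσ.out
  obtain ⟨T, hT, -⟩ := H.exists_isComplement_right 1
  rw [Subgroup.isComplement_iff_existsUnique_inv_mul_mem] at hT
  let X : σ.asModule := σ.asModuleEquiv.symm x
  -- The coefficients of `s X` are constant on cosets `Hg`; keeping only those at the transversal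
  -- `T` gives an element with `H`-norm `s X`.
  let z : σ.asModule →₀ k[G] :=
    (s X).mapRange (fun a ↦ .ofCoeff (a.coeff.filter (· ∈ T))) (by simp [Finsupp.filter_zero])
  have hmul (a : k[G]) (h g : G) :
      (MonoidAlgebra.single h 1 * a).coeff g = a.coeff (h⁻¹ * g) := by
    rw [MonoidAlgebra.coeff_single_mul_eq_mul_coeff (h⁻¹ * g) (by simp [eq_inv_mul_iff_mul_eq]),
      one_mul]
  have hinv (h : H) (g : G) (i) : (s X i).coeff ((h : G)⁻¹ * g) = (s X i).coeff g := by
    have h1 : MonoidAlgebra.single (h : G) (1 : k) • X = X := by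
      rw [single_smul, one_smul]; exact hx h h.2
    conv_rhs => rw [← h1, map_smul]
    simp [hmul]
  have hz : ∑ h : H, MonoidAlgebra.single (h : G) (1 : k) • z = s X := by
    ext i g
    obtain ⟨h₀, h₁, h₂⟩ : ∃! h : H, (h : G)⁻¹ * g ∈ T := hT g
    simp only [Finsupp.finsetSum_apply, MonoidAlgebra.coeff_sum, Finsupp.smul_apply, smul_eq_mul,
      hmul, z, Finsupp.mapRange_apply]
    rw [Finset.sum_eq_single h₀]
    · rw [Finsupp.filter_apply_pos _ _ h₁, hinv]
    · intro h _ hne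
      exact Finsupp.filter_apply_neg _ _ fun hm ↦ hne (h₂ h hm)
    · simp
  refine ⟨σ.asModuleEquiv (Finsupp.linearCombination k[G] id z), ?_⟩
  have := congrArg (Finsupp.linearCombination k[G] (id : σ.asModule → σ.asModule)) hz
  rw [hs X, map_sum] at this
  simp only [map_smul, single_smul, one_smul] at this
  exact this

/-- The relative trace `f ↦ ∑ h, h f h⁻¹` over a finite subgroup `H`. -/
noncomputable def relTrace (ρ : Representation k G V) (H : Subgroup G) [Fintype H] :
    Module.End k (Module.End k V) :=
  norm ((ρ.linHom ρ).comp H.subtype)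

variable (ρ : Representation k G V) (H : Subgroup G) [Fintype H]

theorem relTrace_apply (f : Module.End k V) :
    ρ.relTrace H f = ∑ h : H, ρ h * f * ρ (h : G)⁻¹ := by
  simp only [relTrace, norm, LinearMap.sum_apply]
  rfl

theorem mul_relTrace {φ : Module.End k V} (hφ : ∀ h ∈ H, Commute φ (ρ h)) (f : Module.End k V) :
    φ * ρ.relTrace H f = ρ.relTrace H (φ * f) := by
  simp only [relTrace_apply, Finset.mul_sum]
  refine Finset.sum_congr rfl fun h _ ↦ ?_
  rw [← mul_assoc, ← mul_assoc, (hφ h h.2).eq, mul_assoc (ρ h)]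

theorem relTrace_mul {φ : Module.End k V} (hφ : ∀ h ∈ H, Commute φ (ρ h)) (f : Module.End k V) :
    ρ.relTrace H f * φ = ρ.relTrace H (f * φ) := by
  simp only [relTrace_apply, Finset.sum_mul]
  refine Finset.sum_congr rfl fun h _ ↦ ?_
  rw [mul_assoc, ← (hφ _ (H.inv_mem h.2)).eq]
  simp only [mul_assoc]

theorem conj_relTrace {g : G} (hg : g ∈ Subgroup.normalizer (H : Set G)) (f : Module.End k V) :
    ρ g * ρ.relTrace H f * ρ g⁻¹ = ρ.relTrace H (ρ g * f * ρ g⁻¹) := by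
  simp only [relTrace_apply, Finset.sum_mul, Finset.mul_sum]
  let e : H ≃ H :=
    { toFun := fun h ↦ ⟨g * h * g⁻¹, (Subgroup.mem_normalizer_iff.1 hg h).1 h.2⟩
      invFun := fun h ↦ ⟨g⁻¹ * h * g, by
        simpa using (Subgroup.mem_normalizer_iff.1 (inv_mem hg) h).1 h.2⟩
      left_inv := fun h ↦ by ext; simp [mul_assoc]
      right_inv := fun h ↦ by ext; simp [mul_assoc] }
  refine Fintype.sum_equiv e _ _ fun h ↦ ?_
  have h1 : ρ (e h) = ρ g * ρ h * ρ g⁻¹ := by simp [e]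
  have h2 : ρ (e h : G)⁻¹ = ρ g * ρ (h : G)⁻¹ * ρ g⁻¹ := by simp [e, mul_assoc]
  have h3 : ρ g⁻¹ * ρ g = 1 := by rw [← map_mul]; simp
  rw [h1, h2]
  simp only [mul_assoc]
  rw [← mul_assoc (ρ g⁻¹) (ρ g), ← mul_assoc (ρ g⁻¹) (ρ g), h3, one_mul, one_mul]

/-- If `ρ` is endotrivial and the characteristic divides `|H|`, then modulo relative traces from
the trivial subgroup, `End_{kH}(V)` is one-dimensional and spanned by the identity. -/
theorem IsEndotrivial.relTrace_spec {k : Type u} {G : Type w} {V : Type v} [Field k] [Group G]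
    [AddCommGroup V] [Module k V] {ρ : Representation k G V} (hρ : ρ.IsEndotrivial)
    (H : Subgroup G) [Fintype H] (hH : (Fintype.card H : k) = 0) :
    (∀ f, ρ.relTrace H f ≠ 1) ∧
    ∀ φ : Module.End k V, (∀ h ∈ H, Commute φ (ρ h)) → ∃ (c : k) (f : Module.End k V),
      φ = c • 1 + ρ.relTrace H f := by
  obtain ⟨_, P, _, _, σ, hσ, ⟨e⟩⟩ := hρ
  let E : Module.End k V ≃ₗ[k] k × P :=
    (dualTensorHomEquiv k V V).symm ≪≫ₗ _root_.TensorProduct.comm k (Module.Dual k V) V ≪≫ₗ e.toLinearEquiv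
  have hEs (g : G) (t : k × P) :
      E.symm ((trivial k G k).prod σ g t) = ρ g * E.symm t * ρ g⁻¹ := by
    have h1 : e.symm ((trivial k G k).prod σ g t) = ρ.tprod ρ.dual g (e.symm t) :=
      IntertwiningMap.isIntertwining _ _ e.symm.toIntertwiningMap g t
    change dualTensorHom k V V (_root_.TensorProduct.comm k _ _ (e.symm ((trivial k G k).prod σ g t))) = _
    rw [h1, tprod_apply, ← _root_.TensorProduct.map_comm]
    exact LinearMap.congr_fun (dualTensorHom_comm ρ ρ g) (_root_.TensorProduct.comm k _ _ (e.symm t))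
  -- On the trivial summand the norm is multiplication by `|H| = 0`.
  have hnorm (t : k × P) : ρ.relTrace H (E.symm t) = E.symm (0, ∑ h : H, σ h t.2) := by
    have : ((0 : k), ∑ h : H, σ h t.2) = ∑ h : H, (trivial k G k).prod σ h t := by
      ext
      · simp [Prod.fst_sum, hH]
      · simp [Prod.snd_sum]
    rw [this, map_sum, relTrace_apply]
    exact Finset.sum_congr rfl fun h _ ↦ (hEs h t).symm
  have hfix (φ : Module.End k V) (hφ : ∀ h ∈ H, Commute φ (ρ h)) (h : G) (hh : h ∈ H) :
      (trivial k G k).prod σ h (E φ) = E φ := by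
    apply E.symm.injective
    rw [hEs, E.symm_apply_apply, ← (hφ h hh).eq, mul_assoc, ← map_mul]
    simp
  have hmem (φ : Module.End k V) (hφ : ∀ h ∈ H, Commute φ (ρ h)) (h0 : (E φ).1 = 0) :
      ∃ f, ρ.relTrace H f = φ := by
    obtain ⟨y, hy⟩ := exists_sum_eq_of_projective σ hσ H (E φ).2 fun h hh ↦
      congrArg Prod.snd (hfix φ hφ h hh)
    refine ⟨E.symm (0, y), ?_⟩
    rw [hnorm, hy, ← h0, Prod.mk.eta, E.symm_apply_apply]
  have hne (f : Module.End k V) : ρ.relTrace H f ≠ 1 := by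
    intro hf
    -- If `1` were a trace, so would be every endomorphism commuting with `H`, including `E.symm (1,
    -- 0)`; but traces have zero `k`-coordinate.
    have hcomm : ∀ h ∈ H, Commute (E.symm (1, 0)) (ρ h) := fun h _ ↦ by
      have h1 := hEs h (1, 0)
      have h2 : (trivial k G k).prod σ h ((1 : k), (0 : P)) = (1, 0) := by ext <;> simp
      rw [h2] at h1
      have h3 : ρ h⁻¹ * ρ h = 1 := by rw [← map_mul]; simp
      rw [commute_iff_eq]
      nth_rw 1 [h1]
      rw [mul_assoc, h3, mul_one]
    have h1 := mul_relTrace ρ H hcomm f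
    rw [hf, mul_one, ← E.symm_apply_apply (E.symm (1, 0) * f), hnorm] at h1
    simpa using congrArg Prod.fst (E.symm.injective h1)
  refine ⟨hne, fun φ hφ ↦ ?_⟩
  have h1 : (E 1).1 ≠ 0 := fun h0 ↦ by
    obtain ⟨f, hf⟩ := hmem 1 (fun h _ ↦ Commute.one_left _) h0
    exact hne f hf
  -- The scalar cancels the `k`-coordinate, leaving a fixed vector of `P`, which is a norm.
  obtain ⟨f, hf⟩ := hmem (φ - ((E φ).1 / (E 1).1) • 1)
    (fun h hh ↦ (hφ h hh).sub_left ((Commute.one_left _).smul_left _)) (by simp [h1])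
  exact ⟨_, f, by rw [hf]; abel⟩

end RelTrace

end Representation

/-! ### Stable subspaces, Clifford theory and descent. -/

namespace Representation

section Invariant

variable {k G V : Type*} [Field k] [Group G] [AddCommGroup V] [Module k V]

/-- The subspace `U` is stable under the subgroup `H`. -/
def IsStable (ρ : Representation k G V) (H : Subgroup G) (U : Submodule k V) : Prop :=
  ∀ h ∈ H, ∀ x ∈ U, ρ h x ∈ U

/-- The only subspaces stable under `H` are `⊥` and `⊤`. -/
def HasOnlyTrivialStable (ρ : Representation k G V) (H : Subgroup G) : Prop :=
  ∀ U : Submodule k V, ρ.IsStable H U → U = ⊥ ∨ U = ⊤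

variable {ρ : Representation k G V} {H K : Subgroup G} {U W : Submodule k V}

theorem IsStable.sup (hU : ρ.IsStable H U) (hW : ρ.IsStable H W) : ρ.IsStable H (U ⊔ W) := by
  intro h hh x hx
  obtain ⟨y, hy, z, hz, rfl⟩ := Submodule.mem_sup.1 hx
  rw [map_add]
  exact Submodule.add_mem_sup (hU h hh y hy) (hW h hh z hz)

theorem IsStable.inf (hU : ρ.IsStable H U) (hW : ρ.IsStable H W) : ρ.IsStable H (U ⊓ W) :=
  fun h hh x hx ↦ ⟨hU h hh x hx.1, hW h hh x hx.2⟩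

theorem IsStable.bot : ρ.IsStable H ⊥ := by
  intro h _ x hx
  rw [Submodule.mem_bot] at hx ⊢
  rw [hx, map_zero]

theorem IsStable.map (hU : ρ.IsStable H U) {g : G} (hg : g ∈ Subgroup.normalizer (H : Set G)) :
    ρ.IsStable H (U.map (ρ g)) := by
  rintro h hh _ ⟨x, hx, rfl⟩
  refine ⟨ρ (g⁻¹ * h * g) x, hU _ ?_ x hx, ?_⟩
  · simpa using (Subgroup.mem_normalizer_iff.1 (inv_mem hg) h).1 hh
  · rw [← Module.End.mul_apply, ← Module.End.mul_apply, ← map_mul, ← map_mul]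
    congr 2
    group

theorem map_map_inv (g : G) (U : Submodule k V) : (U.map (ρ g⁻¹)).map (ρ g) = U := by
  rw [← Submodule.map_comp, ← Module.End.mul_eq_comp, ← map_mul, mul_inv_cancel, map_one]
  exact Submodule.map_id U

theorem map_inv_map (g : G) (U : Submodule k V) : (U.map (ρ g)).map (ρ g⁻¹) = U := by
  simpa using map_map_inv (ρ := ρ) g⁻¹ U

/-- Clifford's theorem: if `ρ` is irreducible on `K` and `K` normalizes `H`, then
`ρ` is semisimple on `H`. -/
theorem HasOnlyTrivialStable.exists_isCompl [FiniteDimensional k V]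
    (hK : ρ.HasOnlyTrivialStable K) (hKH : K ≤ Subgroup.normalizer (H : Set G))
    (hU : ρ.IsStable H U) : ∃ W, ρ.IsStable H W ∧ IsCompl U W := by
  rcases subsingleton_or_nontrivial V with hV | hV
  · exact ⟨⊥, .bot, by rw [Subsingleton.elim U ⊤]; exact isCompl_top_bot⟩
  obtain ⟨S, ⟨hS, hS0⟩, hSmin⟩ := wellFounded_lt.has_min
    {S : Submodule k V | ρ.IsStable H S ∧ S ≠ ⊥} ⟨⊤, fun _ _ _ _ ↦ Submodule.mem_top, top_ne_bot⟩
  obtain ⟨W, ⟨hW, hUW⟩, hWmax⟩ := wellFounded_gt.has_min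
    {W : Submodule k V | ρ.IsStable H W ∧ Disjoint U W} ⟨⊥, .bot, disjoint_bot_right⟩
  refine ⟨W, hW, hUW, codisjoint_iff.2 ?_⟩
  -- Translates of `S` are again minimal; one outside `U ⊔ W` would meet it trivially and could
  -- enlarge `W`.
  have hle : ∀ g ∈ K, S.map (ρ g) ≤ U ⊔ W := by
    intro g hg
    by_contra hnot
    have hdisj : Disjoint (U ⊔ W) (S.map (ρ g)) := by
      rw [disjoint_comm, disjoint_iff]
      by_contra hne
      have hst : ρ.IsStable H ((S.map (ρ g) ⊓ (U ⊔ W)).map (ρ g⁻¹)) :=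
        ((hS.map (hKH hg)).inf (hU.sup hW)).map (inv_mem (hKH hg))
      refine hSmin _ ⟨hst, fun h0 ↦ hne ?_⟩ (lt_of_le_of_ne ?_ fun h0 ↦ hnot ?_)
      · rw [← map_map_inv (ρ := ρ) g (S.map (ρ g) ⊓ (U ⊔ W)), h0, Submodule.map_bot]
      · conv_rhs => rw [← map_inv_map (ρ := ρ) g S]
        exact Submodule.map_mono inf_le_left
      · rw [← h0, map_map_inv]
        exact inf_le_right
    have hmax := hWmax (W ⊔ S.map (ρ g))
      ⟨hW.sup (hS.map (hKH hg)), hUW.disjoint_sup_right_of_disjoint_sup_left hdisj⟩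
    have hSW : S.map (ρ g) ≤ W := by
      by_contra h
      exact hmax (left_lt_sup.2 h)
    exact hnot (hSW.trans le_sup_right)
  have hT : ρ.IsStable K (⨆ g : K, S.map (ρ g)) := by
    intro a ha x hx
    have h1 : (⨆ g : K, S.map (ρ g)).map (ρ a) ≤ ⨆ g : K, S.map (ρ g) := by
      rw [Submodule.map_iSup]
      refine iSup_le fun g ↦ ?_
      rw [← Submodule.map_comp, ← Module.End.mul_eq_comp, ← map_mul]
      exact le_iSup (fun g : K ↦ S.map (ρ g)) (⟨a, ha⟩ * g)
    exact h1 ⟨x, hx, rfl⟩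
  rcases hK _ hT with h | h
  · refine absurd (le_bot_iff.1 ?_) hS0
    rw [← h]
    exact fun x hx ↦ le_iSup (fun g : K ↦ S.map (ρ g)) 1 ⟨x, hx, by simp⟩
  · rw [eq_top_iff, ← h]
    exact iSup_le fun g ↦ hle g g.2

theorem commute_projection (hU : ρ.IsStable H U) (hW : ρ.IsStable H W) (hUW : IsCompl U W) :
    ∀ h ∈ H, Commute (U.projection W hUW : Module.End k V) (ρ h) := by
  intro h hh
  refine LinearMap.ext fun x ↦ ?_
  obtain ⟨y, hy, z, hz, rfl⟩ := Submodule.mem_sup.1 (hUW.sup_eq_top ▸ Submodule.mem_top : x ∈ U ⊔ W)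
  simp only [Module.End.mul_apply, map_add]
  rw [Submodule.projection_apply_of_mem_left hUW hy,
    Submodule.projection_apply_of_mem_left hUW (hU h hh y hy),
    Submodule.projection_apply_of_mem_right hUW hz,
    Submodule.projection_apply_of_mem_right hUW (hW h hh z hz), map_zero]

/-- The subspace `U` is `H`-stable, and every `kH`-endomorphism with image in `U` is a relative
trace from the trivial subgroup. When `ρ` is semisimple on `H` this says that `U` is a
projective `kH`-module. -/
def IsTraceStable (ρ : Representation k G V) (H : Subgroup G) [Fintype H]
    (U : Submodule k V) : Prop :=
  ρ.IsStable H U ∧ ∀ φ : Module.End k V, (∀ h ∈ H, Commute φ (ρ h)) → (∀ x, φ x ∈ U) →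
    ∃ f, ρ.relTrace H f = φ

variable [Fintype H]

theorem IsTraceStable.bot : ρ.IsTraceStable H ⊥ :=
  ⟨.bot, fun φ _ h ↦ ⟨0, by ext x; simpa using (h x).symm⟩⟩

theorem IsTraceStable.map (hU : ρ.IsTraceStable H U) {g : G}
    (hg : g ∈ Subgroup.normalizer (H : Set G)) : ρ.IsTraceStable H (U.map (ρ g)) := by
  have hgg : ρ g * ρ g⁻¹ = 1 := by rw [← map_mul]; simp
  refine ⟨hU.1.map hg, fun φ hφ hφU ↦ ?_⟩
  have hcomm : ∀ h ∈ H, Commute (ρ g⁻¹ * φ * ρ g) (ρ h) := by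
    intro h hh
    have h1 : ρ g * ρ h = ρ (g * h * g⁻¹) * ρ g := by rw [← map_mul, ← map_mul]; simp
    have h2 : ρ g⁻¹ * ρ (g * h * g⁻¹) = ρ h * ρ g⁻¹ := by
      rw [← map_mul, ← map_mul]; simp [mul_assoc]
    have h3 := (hφ _ ((Subgroup.mem_normalizer_iff.1 hg h).1 hh)).eq
    calc ρ g⁻¹ * φ * ρ g * ρ h = ρ g⁻¹ * (φ * ρ (g * h * g⁻¹)) * ρ g := by
          rw [mul_assoc, h1]; simp only [mul_assoc]
      _ = ρ g⁻¹ * ρ (g * h * g⁻¹) * φ * ρ g := by rw [h3]; simp only [mul_assoc]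
      _ = ρ h * (ρ g⁻¹ * φ * ρ g) := by rw [h2]; simp only [mul_assoc]
  have hrange (x : V) : (ρ g⁻¹ * φ * ρ g) x ∈ U := by
    obtain ⟨y, hy, hxy⟩ := hφU (ρ g x)
    have : (ρ g⁻¹ * φ * ρ g) x = y := by
      simp only [Module.End.mul_apply]
      rw [← hxy, inv_self_apply]
    rwa [this]
  obtain ⟨f, hf⟩ := hU.2 _ hcomm hrange
  refine ⟨ρ g * f * ρ g⁻¹, ?_⟩
  rw [← conj_relTrace ρ H hg, hf]
  calc ρ g * (ρ g⁻¹ * φ * ρ g) * ρ g⁻¹ = (ρ g * ρ g⁻¹) * φ * (ρ g * ρ g⁻¹) := by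
        simp only [mul_assoc]
    _ = φ := by rw [hgg, one_mul, mul_one]

/-- Semisimplicity gives `U ⊔ W = U ⊕ (D ⊓ W)`; the projection `e` onto `U` splits `φ` into `eφ` and
`(1 - e)φ`, with images in `U` and `W`. -/
theorem IsTraceStable.sup
    (hc : ∀ U : Submodule k V, ρ.IsStable H U → ∃ W, ρ.IsStable H W ∧ IsCompl U W)
    (hU : ρ.IsTraceStable H U) (hW : ρ.IsTraceStable H W) : ρ.IsTraceStable H (U ⊔ W) := by
  refine ⟨hU.1.sup hW.1, fun φ hφ hφr ↦ ?_⟩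
  obtain ⟨D, hD, hDc⟩ := hc _ (hU.1.inf hW.1)
  obtain ⟨C, hC, hCc⟩ := hc _ (hU.1.sup hW.1)
  have hmod : U ⊓ W ⊔ D ⊓ W = W := by
    rw [← sup_inf_assoc_of_le D (inf_le_right : U ⊓ W ≤ W), hDc.sup_eq_top, top_inf_eq]
  have hsup : U ⊔ D ⊓ W = U ⊔ W := by
    refine le_antisymm (sup_le_sup_left inf_le_right _) (sup_le le_sup_left ?_)
    conv_lhs => rw [← hmod]
    exact sup_le_sup_right inf_le_left _
  have hcompl : IsCompl U (D ⊓ W ⊔ C) := by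
    refine ⟨Disjoint.disjoint_sup_right_of_disjoint_sup_left ?_ (hsup ▸ hCc.disjoint),
      codisjoint_iff.2 (by rw [← sup_assoc, hsup, hCc.sup_eq_top])⟩
    rw [disjoint_iff, inf_comm D W, ← inf_assoc]
    exact hDc.inf_eq_bot
  let e : Module.End k V := U.projection _ hcompl
  have he := commute_projection hU.1 ((hD.inf hW.1).sup hC) hcompl
  obtain ⟨f₁, hf₁⟩ := hU.2 (e * φ) (fun h hh ↦ (he h hh).mul_left (hφ h hh))
    (fun x ↦ Submodule.projection_apply_mem hcompl _)
  obtain ⟨f₂, hf₂⟩ := hW.2 ((1 - e) * φ)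
    (fun h hh ↦ ((Commute.one_left _).sub_left (he h hh)).mul_left (hφ h hh)) (fun x ↦ by
      have hx := hφr x
      rw [← hsup] at hx
      obtain ⟨y, hy, z, hz, hyz⟩ := Submodule.mem_sup.1 hx
      have : ((1 - e) * φ) x = z := by
        simp only [Module.End.mul_apply, LinearMap.sub_apply, Module.End.one_apply, ← hyz, map_add,
          e, Submodule.projection_apply_of_mem_left hcompl hy,
          Submodule.projection_apply_of_mem_right hcompl (Submodule.mem_sup_left hz)]
        abel
      rw [this]
      exact hz.2)
  exact ⟨f₁ + f₂, by rw [map_add, hf₁, hf₂]; noncomm_ring⟩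

/-- If modulo relative traces `End_{kH}(V)` is spanned by the identity, and the identity is not
a relative trace, then irreducibility descends to `H` from any `K` normalizing `H`. -/
theorem HasOnlyTrivialStable.of_relTrace [FiniteDimensional k V]
    (hK : ρ.HasOnlyTrivialStable K) (hKH : K ≤ Subgroup.normalizer (H : Set G))
    (hone : ∀ f, ρ.relTrace H f ≠ 1)
    (hspan : ∀ φ : Module.End k V, (∀ h ∈ H, Commute φ (ρ h)) → ∃ (c : k) (f : Module.End k V),
      φ = c • 1 + ρ.relTrace H f) : ρ.HasOnlyTrivialStable H := by
  have hc : ∀ U : Submodule k V, ρ.IsStable H U → ∃ W, ρ.IsStable H W ∧ IsCompl U W :=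
    fun U hU ↦ hK.exists_isCompl hKH hU
  obtain ⟨M, hM, hMmax⟩ := wellFounded_gt.has_min
    {M : Submodule k V | ρ.IsTraceStable H M} ⟨⊥, .bot⟩
  have hMle (U : Submodule k V) (hU : ρ.IsTraceStable H U) : U ≤ M := by
    by_contra h
    exact hMmax _ (hM.sup hc hU) (left_lt_sup.2 h)
  -- `M` contains its `K`-translates, and `M = ⊤` would make `1` a trace.
  have hMbot : M = ⊥ := by
    refine (hK M fun g hg x hx ↦ hMle _ (hM.map (hKH hg)) ⟨x, hx, rfl⟩).resolve_right fun h ↦ ?_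
    obtain ⟨f, hf⟩ := hM.2 1 (fun h _ ↦ Commute.one_left _) (fun x ↦ by simp [h])
    exact hone f hf
  have hbot (U W : Submodule k V) (hU : ρ.IsStable H U) (hW : ρ.IsStable H W) (hUW : IsCompl U W)
      (h : ∃ f, ρ.relTrace H f = U.projection W hUW) : U = ⊥ := by
    obtain ⟨f, hf⟩ := h
    refine le_bot_iff.1 (hMbot ▸ hMle U ⟨hU, fun φ hφ hφU ↦ ⟨f * φ, ?_⟩⟩)
    rw [← relTrace_mul ρ H hφ, hf]
    exact LinearMap.ext fun x ↦ Submodule.projection_apply_of_mem_left hUW (hφU x)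
  intro U hU
  obtain ⟨W, hW, hUW⟩ := hc U hU
  let e : Module.End k V := U.projection W hUW
  have he : ∀ h ∈ H, Commute e (ρ h) := commute_projection hU hW hUW
  have hsub : W.projection U hUW.symm = 1 - e := by
    refine LinearMap.ext fun x ↦ ?_
    obtain ⟨y, hy, z, hz, rfl⟩ :=
      Submodule.mem_sup.1 (hUW.sup_eq_top ▸ Submodule.mem_top : x ∈ U ⊔ W)
    simp [e, Submodule.projection_apply_of_mem_left hUW hy,
      Submodule.projection_apply_of_mem_left hUW.symm hz,
      Submodule.projection_apply_of_mem_right hUW hz,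
      Submodule.projection_apply_of_mem_right hUW.symm hy]
  have hidem : (1 - e) * e = 0 := by
    refine LinearMap.ext fun x ↦ ?_
    have : e (e x) = e x :=
      Submodule.projection_apply_of_mem_left hUW (Submodule.projection_apply_mem hUW x)
    simp [this]
  obtain ⟨c, f, hf⟩ := hspan e he
  by_cases h0 : c = 0
  · exact Or.inl (hbot U W hU hW hUW ⟨f, by simpa [h0, e] using hf.symm⟩)
  · right
    have hWbot : W = ⊥ := by
      refine hbot W U hW hU hUW.symm ⟨-(c⁻¹ • ((1 - e) * f)), ?_⟩
      -- Multiply `e = c + tr f` on the left by `1 - e`.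
      have h1 : c • (1 - e) + ρ.relTrace H ((1 - e) * f) = 0 := by
        rw [← mul_relTrace ρ H fun h hh ↦ (Commute.one_left _).sub_left (he h hh), ← hidem]
        nth_rw 4 [hf]
        rw [mul_add, mul_smul_comm, mul_one]
      rw [hsub, map_neg, map_smul, eq_neg_of_add_eq_zero_right h1, smul_neg, neg_neg, smul_smul,
        inv_mul_cancel₀ h0, one_smul]
    simpa [hWbot] using hUW.sup_eq_top

end Invariant

end Representation

/-! ### Restriction to subnormal subgroups and Schur's lemma. -/

namespace Representation

section Restriction

variable {k G V : Type*} [Field k] [Group G] [AddCommGroup V] [Module k V]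
  {ρ : Representation k G V} {H : Subgroup G}

theorem IsIrreducible.hasOnlyTrivialStable_top (hρ : ρ.IsIrreducible) :
    ρ.HasOnlyTrivialStable ⊤ := by
  intro U hU
  rcases hρ.eq_bot_or_eq_top ⟨U, fun g x hx ↦ hU g (Subgroup.mem_top g) x hx⟩ with h | h
  · exact Or.inl (congrArg Subrepresentation.toSubmodule h)
  · exact Or.inr (congrArg Subrepresentation.toSubmodule h)

theorem IsIrreducible.nontrivial (hρ : ρ.IsIrreducible) : Nontrivial V := by
  by_contra hV
  rw [not_nontrivial_iff_subsingleton] at hV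
  exact bot_ne_top (α := Subrepresentation ρ)
    (Subrepresentation.toSubmodule_injective (Subsingleton.elim _ _))

theorem HasOnlyTrivialStable.isIrreducible_comp_subtype [Nontrivial V]
    (hρ : ρ.HasOnlyTrivialStable H) : IsIrreducible (ρ.comp H.subtype) where
  exists_pair_ne := ⟨⊥, ⊤, fun h ↦
    bot_ne_top (α := Submodule k V) (congrArg Subrepresentation.toSubmodule h)⟩
  eq_bot_or_eq_top U :=
    (hρ U.toSubmodule fun h hh _ hx ↦ U.apply_mem_toSubmodule ⟨h, hh⟩ hx).imp
      (fun h ↦ Subrepresentation.toSubmodule_injective h)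
      (fun h ↦ Subrepresentation.toSubmodule_injective h)

/-- If a faithful representation over an algebraically closed field stays irreducible on `H`, then
the centralizer of `H` is central. -/
theorem centralizer_eq_center_of_isIrreducible [IsAlgClosed k] [FiniteDimensional k V]
    (hρ : Function.Injective ρ) (hH : IsIrreducible (ρ.comp H.subtype)) :
    Subgroup.centralizer (H : Set G) = Subgroup.center G := by
  refine le_antisymm (fun c hc ↦ ?_) (Subgroup.center_le_centralizer _)
  let f : IntertwiningMap (ρ.comp H.subtype) (ρ.comp H.subtype) :=
    { toLinearMap := ρ c
      isIntertwining' := fun h ↦ by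
        change ρ c * ρ h = ρ h * ρ c
        rw [← map_mul, ← map_mul, Subgroup.mem_centralizer_iff.1 hc h h.2] }
  obtain ⟨a, ha⟩ := (IsIrreducible.algebraMap_intertwiningMap_bijective_of_isAlgClosed
    (ρ := ρ.comp H.subtype)).2 f
  have hca : ρ c = a • 1 := by
    refine LinearMap.ext fun x ↦ ?_
    exact (DFunLike.congr_fun ha x).symm
  refine Subgroup.mem_center_iff.2 fun g ↦ hρ ?_
  rw [map_mul, map_mul, hca, mul_smul_comm, smul_mul_assoc, mul_one, one_mul]

end Restriction

/-- A simple endotrivial module stays simple on subnormal subgroups of order divisible by the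
characteristic. -/
theorem IsEndotrivial.hasOnlyTrivialStable {p : ℕ} {k : Type u} [Field k] [CharP k p]
    {G : Type w} [Group G] [Finite G] {V : Type v} [AddCommGroup V] [Module k V]
    {ρ : Representation k G V} (hend : ρ.IsEndotrivial) (hsimple : ρ.IsIrreducible)
    {N : Subgroup G} (hN : N.IsSubnormal) (hp : p ∣ Nat.card N) : ρ.HasOnlyTrivialStable N := by
  have := hend.1
  induction hN with
  | top => exact hsimple.hasOnlyTrivialStable_top
  | step N K hle _ hn ih =>
    have := Fintype.ofFinite N
    obtain ⟨hone, hspan⟩ := hend.relTrace_spec N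
      (by rwa [← Nat.card_eq_fintype_card, CharP.cast_eq_zero_iff k p])
    exact (ih (hp.trans (Subgroup.card_dvd_of_le hle))).of_relTrace
      ((Subgroup.normal_subgroupOf_iff_le_normalizer hle).1 hn) hone hspan

end Representation

theorem lemma2 {p : ℕ} [Fact p.Prime] {k : Type u} [Field k] [IsAlgClosed k] [CharP k p]
    {G : Type w} [Group G] [Finite G] {V : Type v} [AddCommGroup V] [Module k V]
    (ρ : Representation k G V) (hend : ρ.IsEndotrivial) (hsimple : ρ.IsIrreducible)
    (N : Subgroup G) (hN : N.IsSubnormal) (hp : p ∣ Nat.card N) :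
    Representation.IsIrreducible (ρ.comp N.subtype) ∧
    (N.IsComponent → Function.Injective ρ → 1 < Module.finrank k V →
      Subgroup.centralizer (N : Set G) = Subgroup.center G ∧
      ∀ L : Subgroup G, L.IsComponent → L = N) := by

  have := hend.1
  have := hsimple.nontrivial
  have hirr := (hend.hasOnlyTrivialStable hsimple hN hp).isIrreducible_comp_subtype
  refine ⟨hirr, fun hcomp hinj _ ↦ ?_⟩
  have hcent := Representation.centralizer_eq_center_of_isIrreducible hinj hirr
  refine ⟨hcent, fun L hL ↦ ?_⟩
  by_contra hne
  have hLN := hcomp.commutator_eq_bot_of_ne hL hne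
  rw [Subgroup.commutator_eq_bot_iff_le_centralizer, hcent] at hLN
  exact hL.not_le_center hLN
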